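/- For a finite set $\Omega$ with $n$ elements, a transitive permutation group $G\subseteq \mathrm{Sym}(\Omega)\cong S_n$ and a real number $X$, let $N_n(X;G)$ be the number of number fields $K\subset\overline{\mathbb{Q}}$ with $[K:\mathbb{Q}]=n$ and $|\Delta_K|\le X$ such that the Galois group $\mathrm{Gal}(\widetilde K/\mathbb{Q})$ of the Galois closure $\widetilde K$ of $K$, acting on the $n$ embeddings of $K$ by composition, is isomorphic to $G$ as a permutation group. Fix a base point $\omega\in\Omega$, let $H$ be the stabilizer of $\omega$ in $G$, let $N=N_G(H)$ be its normalizer in $G$ and put $r=|N/H|$. For a coset $c=gH\in N/H$ let $\pi_c$ be the permutation of $\Omega$ given by $\pi_c(h\omega)=hg\,\omega$ for $h\in G$; this is well defined. For $\mathbf{a}=(a_c)_{c\in N/H}\in\mathbb{Z}_{\ge 0}^{N/H}$ define the trace function \[\mathrm{Tr}_{\mathbf{a}}=\sum_{i\in\Omega}\ \prod_{c\in N/H}x_{\pi_c(i)}^{a_c}\in\mathbb{Z}[x_i : i\in\Omega].\] Given integers $k\geq 1$ and $t\ge 2$, let $\mathbf{a}_1,\dots,\mathbf{a}_l$, with $l=\binom{r-1}{k-1}$,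 be the vectors $\mathbf{a}(S)$, where $S$ runs over the $k$-element subsets of $N/H$ that contain the trivial coset; here $\mathbf{a}(S)$ has entry $t$ at the trivial coset, $1$ at the other elements of $S$, and $0$ elsewhere. **Corollary B.** Let $m\ge 1$, let $A$ be a transitive subgroup of $S_m$, and let $B$ be a finite group, regarded as a permutation group on its $|B|$ elements by the regular representation. Let $G=A\times B$, regarded as a transitive permutation group on $\{1,\dots,m\}\times B$, that is, as a subgroup of $S_n$ with $n=m|B|$, via $(a,b)\cdot(i,x)=(a(i),bx)$. Let $k$ and $t$ be integers with $3\le k\le |B|$ and $t\ge 2$. Assume that 1. $\binom{|B|-1}{k-1}\ge m|B|$; 2. for some $n$ distinct vectors $\mathbf{a}_{i_1},\dots,\mathbf{a}_{i_n}$ among $\mathbf{a}_1,\dots,\mathbf{a}_l$, the trace functions $f_j=\mathrm{Tr}_{\mathbf{a}_{i_j}}$ of $G$ have a Jacobian matrix, with respect to the $n$ variables, whose determinant is not the zero polynomial. Then $N_n(X;G)\ll X^{k+t-1}$: there is a constant $C>0$, depending only on $G$, $k$ and $t$, such that for every real $X\ge 1$ the number $N_n(X;G)$ is finite and $N_n(X;G)\le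 C\,X^{k+t-1}$. -/

import Mathlib

namespace TraceCount

/-! ### Trace functions of a transitive permutation group -/

section Trace

variable {Ω : Type*} (G : Subgroup (Equiv.Perm Ω)) (ω : Ω)

/-- The point stabilizer `H` of the base point `ω` in the permutation group `G`. -/
abbrev stab : Subgroup G := MulAction.stabilizer G ω

/-- The normalizer `N` of the point stabilizer `H` in `G`. -/
abbrev normStab : Subgroup G := Subgroup.normalizer (stab G ω : Set G)

/-- The quotient group `N / H`. -/
abbrev NH : Type _ := normStab G ω ⧸ (stab G ω).subgroupOf (normStab G ω)

noncomputable instance instFintypeNH [Finite Ω] : Fintype (NH G ω) := Fintype.ofFinite _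

/-- The map `π_c : Ω → Ω` attached to a coset `c = g H` in `N / H`: the point `i = g_i ω` is sent
to `(g_i g) ω`. Points `g_i ω` of `Ω` correspond to cosets `g_i H`, and `π_c` is then
`g_i H ↦ g_i g H`. See `shift_mk_smul` for the independence of choices. -/
noncomputable def shift [MulAction.IsPretransitive G Ω] (c : NH G ω) (i : Ω) : Ω :=
  ((MulAction.exists_smul_eq G ω i).choose * (c.out : G)) • ω

/-- `π_{gH} (h ω) = (h g) ω` for all `g ∈ N` and `h ∈ G`. -/
theorem shift_mk_smul [MulAction.IsPretransitive G Ω] (g : normStab G ω) (h : G) :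
    shift G ω (QuotientGroup.mk g) (h • ω) = (h * (g : G)) • ω := by
  unfold shift
  have h1 := (MulAction.exists_smul_eq G ω (h • ω)).choose_spec
  set u : G := (MulAction.exists_smul_eq G ω (h • ω)).choose with hu
  set v : normStab G ω := (QuotientGroup.mk g : NH G ω).out with hv
  have h2 : (QuotientGroup.mk v : NH G ω) = QuotientGroup.mk g := by
    rw [hv]; exact Quotient.out_eq _
  have h3 : (v : G)⁻¹ * (g : G) ∈ stab G ω := by
    have := QuotientGroup.eq.mp h2
    simpa [Subgroup.mem_subgroupOf] using this
  have h4 : (v : G) • ω = (g : G) • ω := by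
    have h5 : ((v : G)⁻¹ * (g : G)) • ω = ω := h3
    rw [mul_smul, inv_smul_eq_iff] at h5
    exact h5.symm
  have h6 : h⁻¹ * u ∈ stab G ω := by
    change (h⁻¹ * u) • ω = ω
    rw [mul_smul, h1, inv_smul_smul]
  have h7 : (g : G)⁻¹ * (h⁻¹ * u) * (g : G) ∈ stab G ω := by
    have := (Subgroup.mem_normalizer_iff.mp (inv_mem g.2) (h⁻¹ * u)).mp h6
    simpa using this
  have h8 : ((g : G)⁻¹ * (h⁻¹ * u) * (g : G)) • ω = ω := h7
  rw [mul_smul, h4, ← mul_smul]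
  have h9 : u * (g : G) = (h * (g : G)) * ((g : G)⁻¹ * (h⁻¹ * u) * (g : G)) := by group
  rw [h9, mul_smul (h * (g : G)), h8]

/-- The trace function `Tr_a = ∑_i ∏_j x_{π_j(i)} ^ a_j`, a polynomial in the variables `x_i`,
`i ∈ Ω`, for an exponent vector `a` indexed by `N / H`. -/
noncomputable def traceFn [Fintype Ω] [MulAction.IsPretransitive G Ω] (a : NH G ω → ℕ) :
    MvPolynomial Ω ℤ :=
  ∑ i : Ω, ∏ c : NH G ω, MvPolynomial.X (shift G ω c i) ^ a c

/-- The family `𝒮_k` of the `k`-element subsets of `N / H` that contain the trivial coset. -/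
def subsetsWithOne (k : ℕ) : Set (Finset (NH G ω)) :=
  {S | S.card = k ∧ (1 : NH G ω) ∈ S}

open Classical in
/-- The exponent vector `a(S)`: the entry `t` at the trivial coset, `1` at the other elements of
`S`, and `0` elsewhere. -/
noncomputable def expVec (t : ℕ) (S : Finset (NH G ω)) : NH G ω → ℕ := fun c =>
  if c = 1 then t else if c ∈ S then 1 else 0

end Trace

/-- The Jacobian matrix `(∂ f_i / ∂ x_j)`. -/
noncomputable def jacobianMatrix {Ω : Type*} (f : Ω → MvPolynomial Ω ℤ) :
    Matrix Ω Ω (MvPolynomial Ω ℤ) :=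
  Matrix.of fun i j => MvPolynomial.pderiv j (f i)

/-! ### The product permutation group -/

section Product

variable {m : ℕ} (A : Subgroup (Equiv.Perm (Fin m))) (B : Type*) [Group B]

/-- The product of the inclusion of `A` in `S_m` and the (left) regular representation of `B`,
acting on the `m |B|` points of `Fin m × B`. -/
def prodRegularHom : A × B →* Equiv.Perm (Fin m × B) where
  toFun g := Equiv.prodCongr (g.1 : Equiv.Perm (Fin m)) (Equiv.mulLeft g.2)
  map_one' := by ext x <;> simp
  map_mul' g h := by ext x <;> simp [mul_assoc]

/-- The permutation group `G = A × B` inside the symmetric group on `Fin m × B`. -/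
def prodRegular : Subgroup (Equiv.Perm (Fin m × B)) := (prodRegularHom A B).range

instance instPretransitiveProdRegular [MulAction.IsPretransitive A (Fin m)] :
    MulAction.IsPretransitive (prodRegular A B) (Fin m × B) where
  exists_smul_eq x y := by
    obtain ⟨a, ha⟩ := MulAction.exists_smul_eq A x.1 y.1
    refine ⟨⟨prodRegularHom A B (a, y.2 * x.2⁻¹), ⟨_, rfl⟩⟩, ?_⟩
    refine Prod.ext ha ?_
    change y.2 * x.2⁻¹ * x.2 = y.2
    simp

end Product

/-! ### Counting number fields -/

/-- The Galois closure over `ℚ`, inside a fixed algebraic closure, of a subfield `K`. -/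
noncomputable abbrev galClosure (K : IntermediateField ℚ (AlgebraicClosure ℚ)) :
    IntermediateField ℚ (AlgebraicClosure ℚ) :=
  IntermediateField.normalClosure ℚ K (AlgebraicClosure ℚ)

/-- The Galois group of the Galois closure of `K`, acting on the embeddings `s` of `K` by
`s ↦ τ ∘ s`, is isomorphic to `G` as a permutation group. -/
def HasPermGaloisGroup {Ω : Type*} (G : Subgroup (Equiv.Perm Ω))
    (K : IntermediateField ℚ (AlgebraicClosure ℚ)) : Prop :=
  ∃ (e : (K →ₐ[ℚ] galClosure K) ≃ Ω) (φ : (galClosure K ≃ₐ[ℚ] galClosure K) ≃* G),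
    ∀ (τ : galClosure K ≃ₐ[ℚ] galClosure K) (s : K →ₐ[ℚ] galClosure K),
      e ((τ : galClosure K →ₐ[ℚ] galClosure K).comp s) = (φ τ : Equiv.Perm Ω) (e s)

/-- The number fields `K` of degree `n = |Ω|`, inside a fixed algebraic closure of `ℚ`, with
`|Δ_K| ≤ X` and Galois group isomorphic to `G` as a permutation group. -/
def fieldsWithGroup {Ω : Type*} [Fintype Ω] (G : Subgroup (Equiv.Perm Ω)) (X : ℝ) :
    Set (IntermediateField ℚ (AlgebraicClosure ℚ)) :=
  {K | ∃ _ : NumberField K, Module.finrank ℚ K = Fintype.card Ω ∧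
    |(NumberField.discr K : ℝ)| ≤ X ∧ HasPermGaloisGroup G K}

/-- The counting function `N_n(X; G)`. -/
noncomputable def fieldCount {Ω : Type*} [Fintype Ω] (G : Subgroup (Equiv.Perm Ω)) (X : ℝ) : ℕ :=
  (fieldsWithGroup G X).ncard

end TraceCount

/-! Let n be the degree and d = k + t - 1. The ring of integers of a counted field K contains n
independent elements whose conjugates are all O(|Δ|^(1/n))
(`exists_linearIndependent_integers_norm_le`). Some bounded integral combination α of them avoids a
prescribed hypersurface (`exists_aeval_sum_ne_zero`), so that α generates K and its conjugates are
O(X^(1/n)). Trace functions are G-invariant and homogeneous of degree d, so their values T_j at the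
conjugates of α are rational integers of size O(X^(d/n)).

By the Jacobian criterion (`algebraicIndependent_of_det_jacobian_ne_zero`) the n trace functions are
algebraically independent, hence every variable is algebraic over the ring they generate. Away from
the hypersurface, T therefore determines α up to boundedly many choices. There are O(X^(d/n))^n =
O(X^d) vectors T, and each yields boundedly many fields.

The small integers come from a transference argument. A nonzero β in the trace dual of the ring of
integers has |N β| ≥ 1/|Δ|, so nonzero dual vectors have length at least |Δ|^(-1/n). A lattice
without short dual vectors has a full set of short independent vectors, by induction on the rank. -/

/-- The vectors of a real inner product space that pair integrally with a subgroup `L`. -/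
def AddSubgroup.integralDual {E : Type*} [NormedAddCommGroup E] [InnerProductSpace ℝ E]
    (L : AddSubgroup E) : Set E :=
  {d | ∀ v ∈ L, ∃ z : ℤ, inner ℝ d v = z}

/-! ### Lattices without short dual vectors -/

section Transference

variable {E : Type*} [NormedAddCommGroup E] [InnerProductSpace ℝ E]

/-- A nonzero dual vector `d` such that no nonzero dual vector has norm at most `‖d‖ / 2`
takes the value `1` on the lattice. -/
theorem exists_inner_eq_one_of_near_shortest (L : AddSubgroup E)
    (hL : Submodule.span ℝ (L : Set E) = ⊤) {d : E} (hd : d ∈ L.integralDual) (hd0 : d ≠ 0)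
    (hmin : ∀ d' ∈ L.integralDual, d' ≠ 0 → ‖d‖ < 2 * ‖d'‖) :
    ∃ u ∈ L, inner ℝ d u = (1 : ℝ) := by
  -- The values of `d` on `L` form a subgroup gℤ, and d / g is again a dual vector. Minimality up to
  -- a factor 2 forces |g| < 2, hence g = ±1.
  let H : AddSubgroup ℤ :=
    { carrier := {z | ∃ v ∈ L, inner ℝ d v = (z : ℝ)}
      zero_mem' := ⟨0, L.zero_mem, by simp⟩
      add_mem' := by
        rintro a b ⟨v, hv, hva⟩ ⟨w, hw, hwb⟩
        exact ⟨v + w, L.add_mem hv hw, by rw [inner_add_right, hva, hwb]; push_cast; ring⟩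
      neg_mem' := by
        rintro a ⟨v, hv, hva⟩
        exact ⟨-v, L.neg_mem hv, by rw [inner_neg_right, hva]; push_cast; ring⟩ }
  obtain ⟨g, hg⟩ := Int.subgroup_cyclic H
  have hmem : ∀ z : ℤ, z ∈ H ↔ ∃ k : ℤ, k * g = z := by
    intro z
    rw [hg, AddSubgroup.mem_closure_singleton]
    simp
  have hg0 : g ≠ 0 := by
    rintro rfl
    apply hd0
    have h1 : ∀ x : E, inner ℝ d x = 0 := by
      intro x
      have hx : x ∈ Submodule.span ℝ (L : Set E) := hL ▸ Submodule.mem_top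
      induction hx using Submodule.span_induction with
      | mem v hv =>
        obtain ⟨z, hz⟩ := hd v hv
        obtain ⟨k, hk⟩ := (hmem z).1 ⟨v, hv, hz⟩
        rw [hz, ← hk]; simp
      | zero => simp
      | add a b _ _ ha hb => rw [inner_add_right, ha, hb, add_zero]
      | smul c a _ ha => rw [inner_smul_right, ha, mul_zero]
    exact inner_self_eq_zero.1 (h1 d)
  have hgR : (g : ℝ) ≠ 0 := by exact_mod_cast hg0
  have h2 := hmin ((g : ℝ)⁻¹ • d) (by
    intro v hv
    obtain ⟨z, hz⟩ := hd v hv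
    obtain ⟨k, hk⟩ := (hmem z).1 ⟨v, hv, hz⟩
    refine ⟨k, ?_⟩
    rw [inner_smul_left, hz, ← hk]
    push_cast
    simp
    field_simp) (smul_ne_zero (inv_ne_zero hgR) hd0)
  have hdpos : 0 < ‖d‖ := norm_pos_iff.2 hd0
  rw [norm_smul, norm_inv, Real.norm_eq_abs] at h2
  have hgpos : 0 < |(g : ℝ)| := abs_pos.2 hgR
  have h3 : |(g : ℝ)| < 2 := by
    have : |(g : ℝ)| * ‖d‖ < |(g : ℝ)| * (2 * (|(g : ℝ)|⁻¹ * ‖d‖)) :=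
      mul_lt_mul_of_pos_left h2 hgpos
    have h5 : |(g : ℝ)| * (2 * (|(g : ℝ)|⁻¹ * ‖d‖)) = 2 * ‖d‖ := by field_simp
    rw [h5] at this
    exact lt_of_mul_lt_mul_right this hdpos.le
  have h4 : |g| < 2 := by exact_mod_cast h3
  have h6 : (1 : ℤ) ∈ H := by
    rw [hmem]
    rcases abs_lt.1 h4 with ⟨ha, hb⟩
    have : g = 1 ∨ g = -1 := by omega
    rcases this with rfl | rfl
    · exact ⟨1, rfl⟩
    · exact ⟨-1, rfl⟩
  obtain ⟨u, hu, hu1⟩ := h6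
  exact ⟨u, hu, by simpa using hu1⟩

/-- The sublattice of `L` orthogonal to `d`. -/
noncomputable def AddSubgroup.orthogonalTo (L : AddSubgroup E) (d : E) : AddSubgroup (ℝ ∙ d)ᗮ :=
  L.comap ((ℝ ∙ d)ᗮ.subtype : (ℝ ∙ d)ᗮ →+ E)

/-- Since `d` takes the value 1 at `u`, the lattice splits as (L ∩ d^⊥) ⊕ ℤu, and pairing with `d`
separates the two summands. -/
theorem span_orthogonalTo (L : AddSubgroup E) (hL : Submodule.span ℝ (L : Set E) = ⊤) {d u : E}
    (hd : d ∈ L.integralDual) (hu : u ∈ L) (hdu : inner ℝ d u = (1 : ℝ)) :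
    Submodule.span ℝ (L.orthogonalTo d : Set (ℝ ∙ d)ᗮ) = ⊤ := by
  have key : Submodule.span ℝ (L : Set E) ≤
      (Submodule.span ℝ (L.orthogonalTo d : Set (ℝ ∙ d)ᗮ)).map (ℝ ∙ d)ᗮ.subtype ⊔ ℝ ∙ u := by
    refine Submodule.span_le.2 fun v hv => ?_
    obtain ⟨z, hz⟩ := hd v hv
    have h1 : v - z • u ∈ (ℝ ∙ d)ᗮ := by
      rw [Submodule.mem_orthogonal_singleton_iff_inner_right, inner_sub_right, hz,
        ← Int.cast_smul_eq_zsmul ℝ, inner_smul_right, hdu]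
      simp
    have h2 : v = (v - z • u) + (z : ℝ) • u := by
      rw [Int.cast_smul_eq_zsmul]; abel
    rw [h2]
    refine Submodule.add_mem_sup ?_ (Submodule.smul_mem _ _ (Submodule.mem_span_singleton_self u))
    refine ⟨⟨v - z • u, h1⟩, Submodule.subset_span ?_, rfl⟩
    exact L.sub_mem hv (L.zsmul_mem hu z)
  rw [hL] at key
  refine eq_top_iff.2 fun x _ => ?_
  obtain ⟨y, hy, w, hw, hyw⟩ := Submodule.mem_sup.1 (key (Submodule.mem_top (x := (x : E))))
  obtain ⟨m, hm, rfl⟩ := hy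
  obtain ⟨c, rfl⟩ := Submodule.mem_span_singleton.1 hw
  have h1 := (Submodule.mem_orthogonal_singleton_iff_inner_right).1 x.2
  have h2 := (Submodule.mem_orthogonal_singleton_iff_inner_right).1 m.2
  rw [← hyw, inner_add_right, inner_smul_right, hdu] at h1
  have hc : c = 0 := by
    have : inner ℝ d (m : E) + c * 1 = 0 := h1
    rw [h2] at this
    simpa using this
  have : x = m := by
    apply Subtype.ext
    rw [← hyw, hc]
    simp
  rw [this]
  exact hm

/-- Orthogonal projection to d^⊥ maps dual vectors of `L` to dual vectors of the sublattice, and it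
is onto. -/
theorem span_integralDual_orthogonalTo (L : AddSubgroup E) [FiniteDimensional ℝ E]
    (hL : Submodule.span ℝ L.integralDual = ⊤) (d : E) :
    Submodule.span ℝ (L.orthogonalTo d).integralDual = ⊤ := by
  let p := (ℝ ∙ d)ᗮ.orthogonalProjectionOnto
  have h1 : (Submodule.span ℝ L.integralDual).map (p : E →ₗ[ℝ] (ℝ ∙ d)ᗮ) ≤
      Submodule.span ℝ (L.orthogonalTo d).integralDual := by
    rw [Submodule.map_span]
    refine Submodule.span_mono ?_
    rintro _ ⟨e, he, rfl⟩ m hm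
    obtain ⟨z, hz⟩ := he m hm
    refine ⟨z, ?_⟩
    rw [← hz]
    exact Submodule.inner_orthogonalProjectionOnto_eq_of_mem_right m e
  rw [hL] at h1
  refine eq_top_iff.2 fun x _ => h1 ⟨x, Submodule.mem_top, ?_⟩
  exact Submodule.orthogonalProjectionOnto_mem_subspace_eq_self x

/-- Integrality on L = (L ∩ d^⊥) ⊕ ℤu only has to be arranged at `u`. Adding s • d shifts that value
by s, so rounding to the nearest integer costs at most 1/2. -/
theorem exists_add_smul_mem_integralDual (L : AddSubgroup E) {d u : E}
    (hd : d ∈ L.integralDual) (hu : u ∈ L) (hdu : inner ℝ d u = (1 : ℝ)) (w : (ℝ ∙ d)ᗮ)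
    (hw : w ∈ (L.orthogonalTo d).integralDual) :
    ∃ s : ℝ, |s| ≤ 1 / 2 ∧ (w : E) + s • d ∈ L.integralDual := by
  set a : ℝ := inner ℝ (w : E) u with ha
  refine ⟨round a - a, ?_, fun v hv => ?_⟩
  · rw [abs_sub_comm]; exact abs_sub_round a
  · obtain ⟨z, hz⟩ := hd v hv
    have h1 : v - z • u ∈ (ℝ ∙ d)ᗮ := by
      rw [Submodule.mem_orthogonal_singleton_iff_inner_right, inner_sub_right, hz,
        ← Int.cast_smul_eq_zsmul ℝ, inner_smul_right, hdu]
      simp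
    obtain ⟨y, hy⟩ := hw ⟨v - z • u, h1⟩ (L.sub_mem hv (L.zsmul_mem hu z))
    have hy' : inner ℝ (w : E) (v - z • u) = (y : ℝ) := hy
    rw [inner_sub_right, ← Int.cast_smul_eq_zsmul ℝ, inner_smul_right, ← ha] at hy'
    refine ⟨y + z * round a, ?_⟩
    rw [inner_add_left, inner_smul_left, hz]
    push_cast
    simp only [conj_trivial]
    linarith

/-- By Pythagoras for the lifted vector, ‖w‖² ≥ s² - (1/4)(6/5)² s² = (4/5)² s². Passing to d^⊥ thus
shortens the dual minimum by a bounded factor only. -/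
theorem le_norm_of_mem_integralDual_orthogonalTo (L : AddSubgroup E) {d u : E}
    (hd : d ∈ L.integralDual) (hu : u ∈ L) (hdu : inner ℝ d u = (1 : ℝ)) {s : ℝ} (hs : 0 < s)
    (hmin : ∀ d' ∈ L.integralDual, d' ≠ 0 → s ≤ ‖d'‖) (hds : ‖d‖ ≤ 6 / 5 * s)
    (w : (ℝ ∙ d)ᗮ) (hw : w ∈ (L.orthogonalTo d).integralDual) (hw0 : w ≠ 0) :
    4 / 5 * s ≤ ‖w‖ := by
  obtain ⟨c, hc, hmem⟩ := exists_add_smul_mem_integralDual L hd hu hdu w hw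
  have horth : inner ℝ (w : E) d = 0 := by
    rw [real_inner_comm]
    exact (Submodule.mem_orthogonal_singleton_iff_inner_right).1 w.2
  have hsq : ‖(w : E) + c • d‖ ^ 2 = ‖w‖ ^ 2 + c ^ 2 * ‖d‖ ^ 2 := by
    rw [norm_add_sq_real, inner_smul_right, horth, norm_smul, mul_pow, Real.norm_eq_abs, sq_abs]
    simp
  have hne : (w : E) + c • d ≠ 0 := by
    intro h
    rw [h] at hsq
    have : 0 < ‖w‖ := norm_pos_iff.2 hw0
    have : 0 < ‖w‖ ^ 2 := by positivity
    have : 0 ≤ c ^ 2 * ‖d‖ ^ 2 := by positivity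
    rw [norm_zero] at hsq
    linarith
  have h1 := hmin _ hmem hne
  have h2 : s ^ 2 ≤ ‖w‖ ^ 2 + c ^ 2 * ‖d‖ ^ 2 := by
    rw [← hsq]; gcongr
  have h3 : c ^ 2 ≤ (1 / 2) ^ 2 := sq_le_sq' (by linarith [(abs_le.1 hc).1]) (abs_le.1 hc).2
  have h4 : c ^ 2 * ‖d‖ ^ 2 ≤ (1 / 2) ^ 2 * (6 / 5 * s) ^ 2 := by gcongr
  refine le_of_sq_le_sq ?_ (norm_nonneg _)
  nlinarith

end Transference

/-- A transference theorem: if all nonzero dual vectors of a lattice of rank `n` have norm at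
least `δ`, then the lattice contains `n` linearly independent vectors of norm `O_n(1 / δ)`. -/
theorem exists_linearIndependent_norm_le_of_integralDual (n : ℕ) :
    ∃ C : ℝ, 0 < C ∧ ∀ (E : Type*) [NormedAddCommGroup E] [InnerProductSpace ℝ E]
      [FiniteDimensional ℝ E] (L : AddSubgroup E), Module.finrank ℝ E = n →
      Submodule.span ℝ (L : Set E) = ⊤ → Submodule.span ℝ L.integralDual = ⊤ →
      ∀ δ : ℝ, 0 < δ → (∀ d ∈ L.integralDual, d ≠ 0 → δ ≤ ‖d‖) →
      ∃ v : Fin n → E, (∀ i, v i ∈ L) ∧ LinearIndependent ℝ v ∧ ∀ i, ‖v i‖ ≤ C / δ := by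
  induction n with
  | zero =>
    refine ⟨1, one_pos, ?_⟩
    intro E _ _ _ L _ _ _ δ _ _
    exact ⟨Fin.elim0, fun i => i.elim0, linearIndependent_empty_type, fun i => i.elim0⟩
  | succ n ih =>
    obtain ⟨C, hC, ih⟩ := ih
    -- The new vector costs n(5/4)C + 1 and the old ones (5/4)C; the factor n + 1 covers both.
    refine ⟨(n + 1) * (5 / 4 * C) + 1, by positivity, ?_⟩
    intro E _ _ _ L hn hL hL' δ hδ hmin
    -- A vector within a factor 6/5 of the infimum suffices, so it need not be shown that a shortest
    -- dual vector exists.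
    let T : Set ℝ := {x | ∃ d ∈ L.integralDual, d ≠ 0 ∧ ‖d‖ = x}
    have hT : T.Nonempty := by
      by_contra hT
      have h1 : L.integralDual ⊆ {0} := by
        intro d hd
        by_contra h
        exact hT ⟨_, d, hd, h, rfl⟩
      have h2 : (⊤ : Submodule ℝ E) = ⊥ := by
        rw [← hL']
        exact Submodule.span_eq_bot.2 fun x hx => h1 hx
      have h3 : Module.finrank ℝ (⊤ : Submodule ℝ E) = 0 := by rw [h2]; exact finrank_bot ℝ E
      rw [finrank_top] at h3
      omega
    set s := sInf T
    have hδs : δ ≤ s := le_csInf hT (by rintro _ ⟨d, hd, hd0, rfl⟩; exact hmin d hd hd0)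
    have hspos : 0 < s := hδ.trans_le hδs
    have hTs : ∀ d' ∈ L.integralDual, d' ≠ 0 → s ≤ ‖d'‖ := fun d' hd' h0 =>
      csInf_le ⟨0, by rintro _ ⟨e, -, -, rfl⟩; exact norm_nonneg e⟩ ⟨d', hd', h0, rfl⟩
    obtain ⟨_, ⟨d, hd, hd0, rfl⟩, hds⟩ := exists_lt_of_csInf_lt hT
      (show s < 6 / 5 * s by linarith)
    obtain ⟨u, hu, hdu⟩ := exists_inner_eq_one_of_near_shortest L hL hd hd0
      (fun d' hd' h0 => by linarith [hTs d' hd' h0])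
    have hdpos : 0 < ‖d‖ := norm_pos_iff.2 hd0
    have : Fact (Module.finrank ℝ E = n + 1) := ⟨hn⟩
    have hfr : Module.finrank ℝ (ℝ ∙ d)ᗮ = n := Submodule.finrank_orthogonal_span_singleton hd0
    obtain ⟨v, hvL, hvi, hvn⟩ := ih (ℝ ∙ d)ᗮ (L.orthogonalTo d) hfr
      (span_orthogonalTo L hL hd hu hdu) (span_integralDual_orthogonalTo L hL' d)
      (4 / 5 * δ) (by positivity) (fun w hw hw0 => le_trans (by gcongr)
        (le_norm_of_mem_integralDual_orthogonalTo L hd hu hdu hspos hTs hds.le w hw hw0))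
    have hCδ : C / (4 / 5 * δ) = 5 / 4 * C / δ := by field_simp
    rw [hCδ] at hvn
    let b := basisOfLinearIndependentOfCardEqFinrank' v hvi (by simp [hfr])
    have hb : ∀ i, b i = v i := fun i => by simp [b]
    have hpd : u - (‖d‖ ^ 2)⁻¹ • d ∈ (ℝ ∙ d)ᗮ := by
      rw [Submodule.mem_orthogonal_singleton_iff_inner_right, inner_sub_right, hdu,
        inner_smul_right, real_inner_self_eq_norm_sq, inv_mul_cancel₀ (by positivity), sub_self]
    let p : (ℝ ∙ d)ᗮ := ⟨_, hpd⟩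
    let c := b.repr p
    have hp : (u : E) = p + (‖d‖ ^ 2)⁻¹ • d := (sub_add_cancel _ _).symm
    -- Reducing `u` modulo the `v i` leaves fractional coefficients in d^⊥, while the component
    -- along `d` is d / ‖d‖², of length 1 / ‖d‖ ≤ 1 / δ.
    let u' : E := u - ∑ i, ⌊c i⌋ • (v i : E)
    have hu'L : u' ∈ L := L.sub_mem hu (L.sum_mem fun i _ => L.zsmul_mem (hvL i) _)
    have hpsum : (p : E) = ∑ i, c i • (v i : E) := by
      have := b.sum_repr p
      rw [← this]
      simp [hb, c]
    have hu' : u' = ∑ i, Int.fract (c i) • (v i : E) + (‖d‖ ^ 2)⁻¹ • d := by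
      simp only [u']
      rw [hp, hpsum, add_sub_right_comm, ← Finset.sum_sub_distrib]
      congr 1
      refine Finset.sum_congr rfl fun i _ => ?_
      rw [← Int.cast_smul_eq_zsmul ℝ, ← sub_smul, Int.fract]
    have hvd : ∀ i, inner ℝ d (v i : E) = 0 := fun i =>
      (Submodule.mem_orthogonal_singleton_iff_inner_right).1 (v i).2
    refine ⟨Fin.cons u' fun i => (v i : E), ?_, ?_, ?_⟩
    · exact Fin.cases hu'L hvL
    · rw [linearIndependent_finCons]
      refine ⟨hvi.map' (ℝ ∙ d)ᗮ.subtype (Submodule.ker_subtype _), fun hmem => ?_⟩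
      have h1 : Submodule.span ℝ (Set.range fun i => (v i : E)) ≤ (ℝ ∙ d)ᗮ := by
        rw [Submodule.span_le]
        rintro _ ⟨i, rfl⟩
        exact (v i).2
      -- Pairing with `d` gives 1 at `u'` and 0 on the span of the `v i`.
      have h2 := (Submodule.mem_orthogonal_singleton_iff_inner_right).1 (h1 hmem)
      simp only [u'] at h2
      rw [inner_sub_right, hdu, inner_sum] at h2
      simp [← Int.cast_smul_eq_zsmul ℝ, inner_smul_right, hvd] at h2
    · refine Fin.cases ?_ fun i => ?_
      · have h1 : ‖∑ i, Int.fract (c i) • (v i : E)‖ ≤ ∑ i : Fin n, 5 / 4 * C / δ := by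
          refine norm_sum_le_of_le _ fun i _ => ?_
          rw [norm_smul, Real.norm_eq_abs, abs_of_nonneg (Int.fract_nonneg _)]
          calc Int.fract (c i) * ‖(v i : E)‖ ≤ 1 * ‖(v i : E)‖ := by
                gcongr; exact (Int.fract_lt_one _).le
            _ ≤ _ := by rw [one_mul]; exact hvn i
        have h2 : ‖(‖d‖ ^ 2)⁻¹ • d‖ ≤ 1 / δ := by
          rw [norm_smul, norm_inv, norm_pow, norm_norm]
          have : (‖d‖ ^ 2)⁻¹ * ‖d‖ = 1 / ‖d‖ := by field_simp
          rw [this]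
          exact one_div_le_one_div_of_le hδ (hmin d hd hd0)
        simp only [Fin.cons_zero]
        rw [hu']
        refine (norm_add_le _ _).trans ((add_le_add h1 h2).trans ?_)
        rw [Finset.sum_const, Finset.card_univ, Fintype.card_fin, nsmul_eq_mul, ← mul_div_assoc,
          ← add_div]
        gcongr
        linarith
      · simp only [Fin.cons_succ]
        refine (hvn i).trans ?_
        gcongr
        have : 0 ≤ (n : ℝ) * (5 / 4 * C) := by positivity
        linarith

/-! ### The trace form in Euclidean coordinates -/

section RealEmbedding

open NumberField

variable (K : Type*) [Field K] [NumberField K]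

/-- Composition of an embedding into `ℂ` with complex conjugation. -/
noncomputable def conjEmbedding : (K →ₐ[ℚ] ℂ) ≃ (K →ₐ[ℚ] ℂ) :=
  Function.Involutive.toPerm
    (fun σ => ((Complex.conjAe : ℂ →ₐ[ℝ] ℂ).restrictScalars ℚ).comp σ)
    (fun σ => by ext x; simp)

variable {K}

theorem conjEmbedding_apply (σ : K →ₐ[ℚ] ℂ) (x : K) :
    conjEmbedding K σ x = (starRingEnd ℂ) (σ x) := rfl

theorem sum_eq_zero_of_conjEmbedding_eq_neg (f : (K →ₐ[ℚ] ℂ) → ℝ)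
    (hf : ∀ σ, f (conjEmbedding K σ) = -f σ) : ∑ σ, f σ = 0 := by
  have h := Equiv.sum_comp (conjEmbedding K) f
  simp only [hf, Finset.sum_neg_distrib] at h
  linarith

variable (K) in
/-- The embedding of a number field into Euclidean space `ℝⁿ` with coordinates
`Re (σ a) + Im (σ a)`; it preserves the trace norm. -/
noncomputable def realEmbedding : K →+ EuclideanSpace ℝ (K →ₐ[ℚ] ℂ) where
  toFun a := WithLp.toLp 2 fun σ => (σ a).re + (σ a).im
  map_zero' := by ext σ; simp
  map_add' a b := by ext σ; simp; ring

variable (K) in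
/-- The companion of `realEmbedding` with coordinates `Re (σ b) - Im (σ b)`, dual to it with
respect to the trace form. -/
noncomputable def dualEmbedding : K →+ EuclideanSpace ℝ (K →ₐ[ℚ] ℂ) where
  toFun a := WithLp.toLp 2 fun σ => (σ a).re - (σ a).im
  map_zero' := by ext σ; simp
  map_add' a b := by ext σ; simp; ring

theorem realEmbedding_apply (a : K) (σ : K →ₐ[ℚ] ℂ) :
    realEmbedding K a σ = (σ a).re + (σ a).im := rfl

theorem dualEmbedding_apply (a : K) (σ : K →ₐ[ℚ] ℂ) :
    dualEmbedding K a σ = (σ a).re - (σ a).im := rfl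

/-- At each σ the product of coordinates is Re σ(ba) plus a term that changes sign under complex
conjugation; these terms cancel in the sum. -/
theorem inner_dualEmbedding_realEmbedding (b a : K) :
    inner ℝ (dualEmbedding K b) (realEmbedding K a) = (Algebra.trace ℚ K (b * a) : ℝ) := by
  have h1 : ((Algebra.trace ℚ K (b * a) : ℝ) : ℂ) = ∑ σ : K →ₐ[ℚ] ℂ, σ (b * a) := by
    rw [← trace_eq_sum_embeddings ℂ]
    simp
  have h2 : (Algebra.trace ℚ K (b * a) : ℝ) = ∑ σ : K →ₐ[ℚ] ℂ, (σ (b * a)).re := by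
    rw [← Complex.re_sum, ← h1, Complex.ofReal_re]
  have h3 : ∑ σ : K →ₐ[ℚ] ℂ, ((σ b).re * (σ a).im - (σ b).im * (σ a).re) = 0 :=
    sum_eq_zero_of_conjEmbedding_eq_neg _ fun σ => by
      simp only [conjEmbedding_apply, Complex.conj_re, Complex.conj_im]; ring
  rw [h2, ← add_zero (∑ σ : K →ₐ[ℚ] ℂ, (σ (b * a)).re), ← h3, ← Finset.sum_add_distrib,
    PiLp.inner_apply]
  refine Finset.sum_congr rfl fun σ _ => ?_
  rw [dualEmbedding_apply, realEmbedding_apply, map_mul, Complex.mul_re]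
  simp only [RCLike.inner_apply, conj_trivial]
  ring

theorem sum_re_mul_im_eq_zero (a : K) : ∑ σ : K →ₐ[ℚ] ℂ, 2 * ((σ a).re * (σ a).im) = 0 :=
  sum_eq_zero_of_conjEmbedding_eq_neg _ fun σ => by
    simp only [conjEmbedding_apply, Complex.conj_re, Complex.conj_im]; ring

theorem norm_sq_realEmbedding (a : K) :
    ‖realEmbedding K a‖ ^ 2 = ∑ σ : K →ₐ[ℚ] ℂ, ‖σ a‖ ^ 2 := by
  rw [EuclideanSpace.norm_sq_eq, ← add_zero (∑ σ : K →ₐ[ℚ] ℂ, ‖σ a‖ ^ 2),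
    ← sum_re_mul_im_eq_zero a, ← Finset.sum_add_distrib]
  refine Finset.sum_congr rfl fun σ _ => ?_
  rw [realEmbedding_apply, Real.norm_eq_abs, sq_abs, Complex.sq_norm, Complex.normSq_apply]
  ring

theorem norm_sq_dualEmbedding (a : K) :
    ‖dualEmbedding K a‖ ^ 2 = ∑ σ : K →ₐ[ℚ] ℂ, ‖σ a‖ ^ 2 := by
  rw [EuclideanSpace.norm_sq_eq, ← sub_zero (∑ σ : K →ₐ[ℚ] ℂ, ‖σ a‖ ^ 2),
    ← sum_re_mul_im_eq_zero a, ← Finset.sum_sub_distrib]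
  refine Finset.sum_congr rfl fun σ _ => ?_
  rw [dualEmbedding_apply, Real.norm_eq_abs, sq_abs, Complex.sq_norm, Complex.normSq_apply]
  ring

theorem norm_le_norm_realEmbedding (a : K) (σ : K →ₐ[ℚ] ℂ) : ‖σ a‖ ≤ ‖realEmbedding K a‖ := by
  refine le_of_sq_le_sq ?_ (norm_nonneg _)
  rw [norm_sq_realEmbedding]
  exact Finset.single_le_sum (f := fun σ : K →ₐ[ℚ] ℂ => ‖σ a‖ ^ 2) (fun _ _ => by positivity)
    (Finset.mem_univ σ)

theorem norm_le_norm_dualEmbedding (a : K) (σ : K →ₐ[ℚ] ℂ) : ‖σ a‖ ≤ ‖dualEmbedding K a‖ := by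
  refine le_of_sq_le_sq ?_ (norm_nonneg _)
  rw [norm_sq_dualEmbedding]
  exact Finset.single_le_sum (f := fun σ : K →ₐ[ℚ] ℂ => ‖σ a‖ ^ 2) (fun _ _ => by positivity)
    (Finset.mem_univ σ)

theorem abs_norm_le_norm_dualEmbedding_pow (b : K) :
    |(Algebra.norm ℚ b : ℝ)| ≤ ‖dualEmbedding K b‖ ^ Module.finrank ℚ K := by
  have h1 : ((Algebra.norm ℚ b : ℝ) : ℂ) = ∏ σ : K →ₐ[ℚ] ℂ, σ b := by
    rw [← Algebra.norm_eq_prod_embeddings ℚ ℂ]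
    simp
  rw [← Real.norm_eq_abs, ← Complex.norm_real, h1, norm_prod, ← AlgHom.card ℚ K ℂ,
    ← Finset.card_univ]
  rw [← Finset.prod_const]
  exact Finset.prod_le_prod (fun _ _ => norm_nonneg _) fun σ _ => norm_le_norm_dualEmbedding b σ

variable (K) in
/-- The image of the ring of integers under `realEmbedding`. -/
noncomputable def integerLattice : AddSubgroup (EuclideanSpace ℝ (K →ₐ[ℚ] ℂ)) :=
  ((realEmbedding K).comp (algebraMap (𝓞 K) K : 𝓞 K →+ K)).range

theorem mem_integerLattice (x : 𝓞 K) : realEmbedding K (x : K) ∈ integerLattice K := ⟨x, rfl⟩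

theorem trace_dualBasis_integralBasis [DecidableEq (Module.Free.ChooseBasisIndex ℤ (𝓞 K))]
    (i j : Module.Free.ChooseBasisIndex ℤ (𝓞 K)) :
    Algebra.trace ℚ K ((Algebra.traceForm ℚ K).dualBasis (traceForm_nondegenerate ℚ K)
      (integralBasis K) i * integralBasis K j) = if j = i then 1 else 0 := by
  rw [← Algebra.traceForm_apply]
  exact LinearMap.BilinForm.apply_dualBasis_left (traceForm_nondegenerate ℚ K) (integralBasis K) i j

theorem inner_dualBasis_integralBasis [DecidableEq (Module.Free.ChooseBasisIndex ℤ (𝓞 K))]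
    (i j : Module.Free.ChooseBasisIndex ℤ (𝓞 K)) :
    inner ℝ (dualEmbedding K ((Algebra.traceForm ℚ K).dualBasis (traceForm_nondegenerate ℚ K)
      (integralBasis K) i)) (realEmbedding K (integralBasis K j)) = if j = i then (1 : ℝ) else 0 := by
  rw [inner_dualEmbedding_realEmbedding, trace_dualBasis_integralBasis]
  split_ifs <;> simp

end RealEmbedding

/-- Two biorthogonal families in an inner product space: the first one is independent. -/
theorem linearIndependent_of_biorthogonal {E ι : Type*} [NormedAddCommGroup E]
    [InnerProductSpace ℝ E] [DecidableEq ι] {v w : ι → E}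
    (h : ∀ i j, inner ℝ (w i) (v j) = if j = i then (1 : ℝ) else 0) : LinearIndependent ℝ v := by
  rw [linearIndependent_iff']
  intro s c hc i hi
  have h1 : inner ℝ (w i) (∑ j ∈ s, c j • v j) = c i := by
    rw [inner_sum]
    simp [inner_smul_right, h, hi]
  rw [← h1, hc, inner_zero_right]

/-! ### Small independent integers in a number field -/

section Minima

open NumberField

variable (K : Type*) [Field K] [NumberField K]

theorem finrank_euclideanSpace_embeddings :
    Module.finrank ℝ (EuclideanSpace ℝ (K →ₐ[ℚ] ℂ)) = Module.finrank ℚ K := by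
  rw [finrank_euclideanSpace, AlgHom.card]

theorem span_realEmbedding_integralBasis :
    Submodule.span ℝ (Set.range fun i => realEmbedding K (integralBasis K i)) = ⊤ := by
  classical
  refine LinearIndependent.span_eq_top_of_card_eq_finrank'
    (linearIndependent_of_biorthogonal (fun i j => inner_dualBasis_integralBasis (K := K) i j)) ?_
  rw [finrank_euclideanSpace_embeddings, Module.finrank_eq_card_basis (integralBasis K)]

theorem span_integerLattice :
    Submodule.span ℝ (integerLattice K : Set (EuclideanSpace ℝ (K →ₐ[ℚ] ℂ))) = ⊤ := by
  refine eq_top_iff.2 ((span_realEmbedding_integralBasis K).symm.le.trans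
    (Submodule.span_mono ?_))
  rintro _ ⟨i, rfl⟩
  dsimp only
  rw [integralBasis_apply]
  exact mem_integerLattice _

/-- The trace-dual basis of an integral basis maps to dual vectors, which are independent by
biorthogonality. -/
theorem span_integralDual_integerLattice :
    Submodule.span ℝ (integerLattice K).integralDual = ⊤ := by
  classical
  set b' := (Algebra.traceForm ℚ K).dualBasis (traceForm_nondegenerate ℚ K) (integralBasis K)
  have h1 : Submodule.span ℝ (Set.range fun i => dualEmbedding K (b' i)) = ⊤ := by
    refine LinearIndependent.span_eq_top_of_card_eq_finrank'
      (linearIndependent_of_biorthogonal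
        (w := fun i => realEmbedding K (integralBasis K i)) (fun i j => ?_)) ?_
    · rw [real_inner_comm, inner_dualBasis_integralBasis]
      simp only [eq_comm]
    · rw [finrank_euclideanSpace_embeddings, Module.finrank_eq_card_basis (integralBasis K)]
  refine eq_top_iff.2 (h1.symm.le.trans (Submodule.span_mono ?_))
  rintro _ ⟨i, rfl⟩ _ ⟨x, rfl⟩
  refine ⟨(RingOfIntegers.basis K).repr x i, ?_⟩
  change inner ℝ (dualEmbedding K (b' i)) (realEmbedding K (x : K)) = _
  rw [inner_dualEmbedding_realEmbedding]
  have h2 : Algebra.trace ℚ K (b' i * x) = (integralBasis K).repr x i := by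
    conv_lhs => rw [← (integralBasis K).sum_repr (x : K)]
    simp only [Finset.mul_sum, mul_smul_comm, map_sum, map_smul, b',
      trace_dualBasis_integralBasis]
    simp
  rw [h2, integralBasis_repr_apply]
  simp

variable {K} in
theorem det_trace_mul_basis {ι : Type*} [Fintype ι] [DecidableEq ι] (b : Module.Basis ι ℚ K) (x : K) :
    (Matrix.of fun i j => Algebra.trace ℚ K (x * (b i * b j))).det =
      Algebra.norm ℚ x * Algebra.discr ℚ b := by
  have h : (Matrix.of fun i j => Algebra.trace ℚ K (x * (b i * b j))) =
      (Algebra.leftMulMatrix b x).transpose * Algebra.traceMatrix ℚ b := by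
    ext i j
    rw [Matrix.mul_apply, Matrix.of_apply, ← mul_assoc]
    conv_lhs => rw [← b.sum_repr (x * b i)]
    rw [Finset.sum_mul, map_sum]
    refine Finset.sum_congr rfl fun k _ => ?_
    rw [Matrix.transpose_apply, Algebra.leftMulMatrix_eq_repr_mul, smul_mul_assoc, map_smul,
      smul_eq_mul, Algebra.traceMatrix_apply, Algebra.traceForm_apply]
  rw [h, Matrix.det_mul, Matrix.det_transpose, ← Algebra.norm_eq_matrix_det, Algebra.discr_def]

/-- Nonzero vectors of the dual lattice of the ring of integers have norm at least
`|Δ| ^ (-1/n)`. -/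
theorem one_le_norm_pow_mul_discr (d : EuclideanSpace ℝ (K →ₐ[ℚ] ℂ))
    (hd : d ∈ (integerLattice K).integralDual) (hd0 : d ≠ 0) :
    1 ≤ ‖d‖ ^ Module.finrank ℚ K * |(discr K : ℝ)| := by
  classical
  have hint : ∀ x : 𝓞 K, ∃ z : ℤ, inner ℝ d (realEmbedding K (x : K)) = z :=
    fun x => hd _ (mem_integerLattice x)
  choose z hz using fun i => hint (RingOfIntegers.basis K i)
  set b' := (Algebra.traceForm ℚ K).dualBasis (traceForm_nondegenerate ℚ K) (integralBasis K)
    with hb'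
  -- The integral values of `d` on an integral basis are the coordinates of an element β of the
  -- trace dual with image `d`.
  set β : K := ∑ i, z i • b' i with hβ
  have hdβ : dualEmbedding K β = d := by
    rw [← sub_eq_zero]
    have h1 : ∀ x ∈ Submodule.span ℝ (Set.range fun i => realEmbedding K (integralBasis K i)),
        inner ℝ (dualEmbedding K β - d) x = 0 := by
      intro x hx
      induction hx using Submodule.span_induction with
      | mem v hv =>
        obtain ⟨j, rfl⟩ := hv
        rw [inner_sub_left, hβ, map_sum, sum_inner]
        simp only [map_zsmul, ← Int.cast_smul_eq_zsmul ℝ, inner_smul_left, hb',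
          inner_dualBasis_integralBasis]
        rw [integralBasis_apply, hz]
        simp
      | zero => simp
      | add a b _ _ ha hb => rw [inner_add_right, ha, hb, add_zero]
      | smul c a _ ha => rw [inner_smul_right, ha, mul_zero]
    rw [span_realEmbedding_integralBasis] at h1
    exact inner_self_eq_zero.1 (h1 _ Submodule.mem_top)
  have hβ0 : β ≠ 0 := by
    intro h
    rw [h, map_zero] at hdβ
    exact hd0 hdβ.symm
  -- The matrix Tr(β b_i b_j) is integral with determinant N(β)Δ ≠ 0, so |N(β)Δ| ≥ 1.
  choose w hw using fun i j => hint (RingOfIntegers.basis K i * RingOfIntegers.basis K j)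
  have hdet := det_trace_mul_basis (integralBasis K) β
  have hmat : (Matrix.of fun i j =>
      Algebra.trace ℚ K (β * (integralBasis K i * integralBasis K j))) =
      (Matrix.of w).map (Int.castRingHom ℚ) := by
    ext i j
    have h1 := hw i j
    rw [← hdβ, inner_dualEmbedding_realEmbedding] at h1
    simp only [Matrix.of_apply, Matrix.map_apply, integralBasis_apply]
    exact_mod_cast h1
  rw [hmat, ← RingHom.mapMatrix_apply, ← RingHom.map_det, ← coe_discr] at hdet
  have hne : (Matrix.of w).det ≠ 0 := by
    intro h0
    rw [h0, map_zero, eq_comm, mul_eq_zero] at hdet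
    rcases hdet with h | h
    · exact hβ0 (Algebra.norm_eq_zero_iff.1 h)
    · exact discr_ne_zero K (by exact_mod_cast h)
  have h1 : (1 : ℝ) ≤ |((Matrix.of w).det : ℝ)| := by
    exact_mod_cast Int.one_le_abs hne
  have h2 : ((Matrix.of w).det : ℝ) = (Algebra.norm ℚ β : ℝ) * (discr K : ℝ) := by
    have := congrArg (fun q : ℚ => (q : ℝ)) hdet
    simpa using this
  rw [h2, abs_mul] at h1
  refine h1.trans ?_
  gcongr
  rw [← hdβ]
  exact abs_norm_le_norm_dualEmbedding_pow β

/-- A number field of degree `n` has `n` independent integers all of whose conjugates are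
`O_n(|Δ| ^ (1/n))`. -/
theorem exists_linearIndependent_integers_norm_le (n : ℕ) (hn : n ≠ 0) :
    ∃ C : ℝ, 0 < C ∧ ∀ (K : Type*) [Field K] [NumberField K], Module.finrank ℚ K = n →
      ∃ a : Fin n → 𝓞 K, LinearIndependent ℚ (fun i => (a i : K)) ∧
        ∀ i (σ : K →ₐ[ℚ] ℂ), ‖σ (a i)‖ ≤ C * |(discr K : ℝ)| ^ (n : ℝ)⁻¹ := by
  obtain ⟨C, hC, h⟩ := exists_linearIndependent_norm_le_of_integralDual n
  refine ⟨C, hC, fun K _ _ hK => ?_⟩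
  have hD : 0 < |(discr K : ℝ)| := abs_pos.2 (by exact_mod_cast discr_ne_zero K)
  set s : ℝ := |(discr K : ℝ)| ^ (n : ℝ)⁻¹ with hs
  have hs0 : 0 < s := Real.rpow_pos_of_pos hD _
  have hsn : s ^ n = |(discr K : ℝ)| := Real.rpow_inv_natCast_pow hD.le hn
  obtain ⟨v, hv, hvi, hvn⟩ := h (EuclideanSpace ℝ (K →ₐ[ℚ] ℂ)) (integerLattice K)
    ((finrank_euclideanSpace_embeddings K).trans hK) (span_integerLattice K)
    (span_integralDual_integerLattice K) s⁻¹ (inv_pos.2 hs0) (fun d hd hd0 => by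
      have h1 := one_le_norm_pow_mul_discr K d hd hd0
      rw [hK, ← hsn, ← mul_pow] at h1
      have h2 : 1 ≤ ‖d‖ * s := by
        by_contra hlt
        exact absurd h1 (not_le.2 (pow_lt_one₀ (by positivity) (not_le.1 hlt) hn))
      rwa [inv_eq_one_div, div_le_iff₀ hs0])
  choose a ha using hv
  have ha' : ∀ i, realEmbedding K (a i : K) = v i := ha
  refine ⟨a, ?_, fun i σ => ?_⟩
  · rw [Fintype.linearIndependent_iff] at hvi ⊢
    intro g hg i
    have h1 : ∑ i, (g i : ℝ) • v i = 0 := by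
      rw [← map_zero (realEmbedding K), ← hg, map_sum]
      refine Finset.sum_congr rfl fun j _ => ?_
      rw [← ha']
      ext σ
      simp only [PiLp.smul_apply, realEmbedding_apply, smul_eq_mul]
      simp [Rat.smul_def]
      ring
    exact_mod_cast hvi _ h1 i
  · refine (norm_le_norm_realEmbedding _ σ).trans ?_
    rw [ha']
    have := hvn i
    rwa [div_inv_eq_mul] at this

end Minima

/-! ### The Jacobian criterion and algebraic relations -/

section Jacobian

open MvPolynomial

variable {R ι κ : Type*} [CommRing R]

/-- The chain rule for partial derivatives of a composition of polynomials. -/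
theorem MvPolynomial.pderiv_aeval_eq_sum [Fintype ι] (f : ι → MvPolynomial κ R)
    (p : MvPolynomial ι R) (j : κ) :
    pderiv j (aeval f p) = ∑ i, aeval f (pderiv i p) * pderiv j (f i) := by
  classical
  induction p using MvPolynomial.induction_on with
  | C a => simp [MvPolynomial.algebraMap_eq]
  | add p q hp hq => simp only [map_add, hp, hq, add_mul, Finset.sum_add_distrib]
  | mul_X p i hp =>
    simp only [map_mul, aeval_X, Derivation.leibniz, smul_eq_mul, hp, map_add, pderiv_X,
      add_mul, Finset.sum_add_distrib, Finset.mul_sum]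
    congr 1
    · rw [Finset.sum_eq_single i]
      · simp
      · intro k _ hk; simp [hk.symm]
      · simp
    · exact Finset.sum_congr rfl fun k _ => by ring

theorem MvPolynomial.totalDegree_pderiv_le (p : MvPolynomial ι R) (i : ι) {N : ℕ}
    (hp : p.totalDegree ≤ N + 1) : (pderiv i p).totalDegree ≤ N := by
  classical
  refine Finset.sup_le fun m hm => ?_
  rw [mem_support_iff, coeff_pderiv] at hm
  have h1 := (le_totalDegree (mem_support_iff.2 (left_ne_zero_of_mul hm))).trans hp
  rw [Finsupp.sum_add_index' (fun _ => rfl) fun _ _ _ => rfl,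
    Finsupp.sum_single_index rfl] at h1
  exact Nat.le_of_succ_le_succ h1

theorem MvPolynomial.eq_C_of_pderiv_eq_zero [IsDomain R] [CharZero R] (p : MvPolynomial ι R)
    (h : ∀ i, pderiv i p = 0) : p = C (coeff 0 p) := by
  classical
  ext m
  rw [coeff_C]
  split_ifs with hm
  · rw [hm]
  · obtain ⟨i, hi⟩ := Finsupp.ne_iff.1 (Ne.symm hm)
    have h1 : m = (m - Finsupp.single i 1) + Finsupp.single i 1 := by
      rw [tsub_add_cancel_of_le]
      simpa [Finsupp.single_le_iff] using Nat.one_le_iff_ne_zero.2 hi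
    have h2 := coeff_pderiv p (m - Finsupp.single i 1) (i := i)
    rw [h i, ← h1, coeff_zero, eq_comm, mul_eq_zero] at h2
    exact h2.resolve_right (Nat.cast_add_one_ne_zero _)

/-- The Jacobian criterion in characteristic zero. -/
theorem algebraicIndependent_of_det_jacobian_ne_zero [IsDomain R] [CharZero R] [Fintype ι]
    [DecidableEq ι] (f : ι → MvPolynomial ι R)
    (hf : (Matrix.of fun i j => pderiv j (f i)).det ≠ 0) : AlgebraicIndependent R f := by
  rw [algebraicIndependent_iff]
  -- Induction on the degree of a relation p(f) = 0. Differentiating it shows that the Jacobian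
  -- kills the vector ((∂_i p)(f)), so each ∂_i p is a relation of smaller degree, hence zero, and p
  -- is constant.
  suffices h : ∀ (N : ℕ) (p : MvPolynomial ι R), p.totalDegree ≤ N → aeval f p = 0 → p = 0 from
    fun p => h _ p le_rfl
  intro N
  have hconst : ∀ a : R, aeval f (C a : MvPolynomial ι R) = 0 → (C a : MvPolynomial ι R) = 0 := by
    intro a h0
    simpa [MvPolynomial.algebraMap_eq] using h0
  induction N with
  | zero =>
    intro p hp h0
    rw [totalDegree_eq_zero_iff_eq_C.1 (Nat.le_zero.1 hp)] at h0 ⊢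
    exact hconst _ h0
  | succ N ih =>
    intro p hp h0
    have h1 : Matrix.vecMul (fun i => aeval f (pderiv i p))
        (Matrix.of fun i j => pderiv j (f i)) = 0 := by
      ext1 j
      have h2 := pderiv_aeval_eq_sum f p j
      rw [h0, map_zero] at h2
      exact h2.symm
    have h3 := Matrix.eq_zero_of_vecMul_eq_zero hf h1
    have h4 := eq_C_of_pderiv_eq_zero p fun i =>
      ih _ (totalDegree_pderiv_le p i hp) (congrFun h3 i)
    rw [h4] at h0 ⊢
    exact hconst _ h0

/-- If `f : ι → R[x_i : i ∈ ι]` is algebraically independent, then all variables are roots of one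
nonzero polynomial with coefficients in `R[f]`. -/
theorem AlgebraicIndependent.exists_polynomial_eval_X_eq_zero [IsDomain R] [Fintype ι]
    {f : ι → MvPolynomial ι R} (hf : AlgebraicIndependent R f) :
    ∃ P : Polynomial (MvPolynomial ι R), P ≠ 0 ∧
      ∀ i, P.eval₂ (aeval f : MvPolynomial ι R →ₐ[R] MvPolynomial ι R).toRingHom (X i) = 0 := by
  have htr : IsTranscendenceBasis R f := hf.isTranscendenceBasis_of_lift_trdeg_le_of_finite
    (by rw [MvPolynomial.trdeg_of_isDomain]; simp)
  have halg := htr.isAlgebraic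
  have h : ∀ i, ∃ p : Polynomial (MvPolynomial ι R), p ≠ 0 ∧
      p.eval₂ (aeval f : MvPolynomial ι R →ₐ[R] MvPolynomial ι R).toRingHom (X i) = 0 := by
    intro i
    obtain ⟨p, hp, hp0⟩ := halg.isAlgebraic (X i : MvPolynomial ι R)
    -- Independence identifies R[f] with a polynomial ring, so the coefficients become polynomials
    -- that can be specialised at parameter values.
    refine ⟨p.map (hf.aevalEquiv.symm : _ →+* MvPolynomial ι R), ?_, ?_⟩
    · rwa [Ne, Polynomial.map_eq_zero_iff hf.aevalEquiv.symm.injective]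
    · rw [Polynomial.eval₂_map, ← hp0, Polynomial.aeval_def]
      congr 1
      ext1 x
      exact hf.aeval_repr x
  choose p hp hp0 using h
  refine ⟨∏ i, p i, Finset.prod_ne_zero_iff.2 fun i _ => hp i, fun i => ?_⟩
  rw [Polynomial.eval₂_finsetProd]
  exact Finset.prod_eq_zero (Finset.mem_univ i) (hp0 i)

end Jacobian

/-! ### Avoiding a hypersurface by small combinations -/

section Substitution

open MvPolynomial

variable {ι : Type*} [Fintype ι] {F : Type*} [Field F]

/-- Substitution of linear forms in a polynomial. -/
noncomputable def linearSubst (M : Matrix ι ι F) : MvPolynomial ι F →ₐ[F] MvPolynomial ι F :=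
  aeval fun i => ∑ j, C (M i j) * X j

theorem linearSubst_linearSubst (M N : Matrix ι ι F) (p : MvPolynomial ι F) :
    linearSubst N (linearSubst M p) = linearSubst (M * N) p := by
  have : (linearSubst N).comp (linearSubst M) = linearSubst (M * N) := by
    refine MvPolynomial.algHom_ext fun i => ?_
    simp only [linearSubst, AlgHom.comp_apply, aeval_X, map_sum, map_mul, Matrix.mul_apply,
      algHom_C, MvPolynomial.algebraMap_eq, Finset.mul_sum, Finset.sum_mul]
    rw [Finset.sum_comm]
    exact Finset.sum_congr rfl fun _ _ => Finset.sum_congr rfl fun _ _ => by ring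
  rw [← this, AlgHom.comp_apply]

theorem linearSubst_one [DecidableEq ι] (p : MvPolynomial ι F) :
    linearSubst (1 : Matrix ι ι F) p = p := by
  have : linearSubst (1 : Matrix ι ι F) = AlgHom.id F _ := by
    refine MvPolynomial.algHom_ext fun i => ?_
    simp [linearSubst, Matrix.one_apply]
  rw [this, AlgHom.id_apply]

theorem totalDegree_linearSubst_le (M : Matrix ι ι F) (p : MvPolynomial ι F) :
    (linearSubst M p).totalDegree ≤ p.totalDegree := by
  rw [linearSubst, aeval_def, eval₂_eq]
  refine totalDegree_finsetSum_le fun m hm => ?_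
  refine (totalDegree_mul _ _).trans ?_
  rw [MvPolynomial.algebraMap_eq, totalDegree_C, zero_add]
  refine (totalDegree_finsetProd _ _).trans ?_
  refine le_trans (Finset.sum_le_sum fun i _ => ?_) (le_totalDegree hm)
  refine (totalDegree_pow _ _).trans ?_
  refine (Nat.mul_le_mul_left _ (?_ : _ ≤ 1)).trans (mul_one _).le
  refine totalDegree_finsetSum_le fun j _ => ?_
  refine (totalDegree_mul _ _).trans ?_
  simp

/-- A nonzero integral polynomial does not vanish at some small integral combination of the
columns of an invertible matrix. -/
theorem exists_aeval_sum_ne_zero [CharZero F] [DecidableEq ι] (p : MvPolynomial ι ℤ) (hp : p ≠ 0)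
    (M : Matrix ι ι F)
    (hM : IsUnit M) : ∃ y : ι → ℕ, (∀ j, y j ≤ p.totalDegree) ∧
      aeval (fun i => ∑ j, (y j : F) * M i j) p ≠ 0 := by
  classical
  by_contra! hcon
  set p' : MvPolynomial ι F := MvPolynomial.map (Int.castRingHom F) p with hp'
  have hp'0 : p' ≠ 0 := by
    rw [Ne, hp', map_eq_zero_iff _ (MvPolynomial.map_injective _ Int.cast_injective)]
    exact hp
  have hdeg : p'.totalDegree ≤ p.totalDegree :=
    Finset.sup_mono (support_map_subset _ _)
  have h0 : linearSubst M p' = 0 := by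
    -- A polynomial of degree at most N that vanishes on the grid {0, …, N}^ι is zero; undoing the
    -- invertible substitution then kills `p'`.
    refine eq_zero_of_eval_zero_at_prod_finset _
      (fun _ => (Finset.range (p.totalDegree + 1)).image fun k : ℕ => (k : F)) (fun i => ?_) ?_
    · rw [Finset.card_image_of_injective _ Nat.cast_injective, Finset.card_range]
      have := degreeOf_le_totalDegree (linearSubst M p') i
      have := totalDegree_linearSubst_le M p'
      omega
    · intro x hx
      simp only [Finset.mem_image, Finset.mem_range] at hx
      choose y hy hyx using hx
      have h1 := hcon y fun j => Nat.lt_succ_iff.1 (hy j)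
      rw [← h1, hp', linearSubst, aeval_def, eval₂_map]
      rw [← coe_eval₂Hom, ← RingHom.comp_apply, aeval_def, ← coe_eval₂Hom]
      congr 1
      refine MvPolynomial.ringHom_ext (fun r => by simp) fun i => ?_
      simp [hyx, mul_comm]
  obtain ⟨N, hN⟩ := hM.exists_right_inv
  apply hp'0
  rw [← linearSubst_one p', ← hN, ← linearSubst_linearSubst, h0, map_zero]

end Substitution

/-- The values of a homogeneous polynomial of degree `d` on a polydisc of radius `B` are
`O(B ^ d)`. -/
theorem MvPolynomial.IsHomogeneous.exists_norm_aeval_le {ι : Type*} {f : MvPolynomial ι ℤ} {d : ℕ}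
    (hf : f.IsHomogeneous d) : ∃ c : ℝ, 0 ≤ c ∧ ∀ (B : ℝ) (x : ι → ℂ), (∀ i, ‖x i‖ ≤ B) →
      ‖MvPolynomial.aeval x f‖ ≤ c * B ^ d := by
  refine ⟨∑ m ∈ f.support, |((f.coeff m : ℤ) : ℝ)|, by positivity, fun B x hx => ?_⟩
  rw [MvPolynomial.aeval_def, MvPolynomial.eval₂_eq, Finset.sum_mul]
  refine norm_sum_le_of_le _ fun m hm => ?_
  rw [norm_mul, norm_prod]
  have h1 : ‖algebraMap ℤ ℂ (f.coeff m)‖ = |((f.coeff m : ℤ) : ℝ)| := by simp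
  have h2 : ∑ i ∈ m.support, m i = d := by
    have := hf (MvPolynomial.mem_support_iff.1 hm)
    simpa [Finsupp.weight_apply, Finsupp.sum] using this
  rw [h1, ← h2, ← Finset.prod_pow_eq_pow_sum]
  gcongr with i _
  rw [norm_pow]
  gcongr
  exact hx i

/-! ### Conjugates and Galois invariants -/

section PermutedConjugates

open MvPolynomial NumberField

/-- The matrix of values of distinct embeddings on a basis is invertible. -/
theorem isUnit_matrix_embeddings {ι K F : Type*} [Fintype ι] [DecidableEq ι] [Field K] [Field F]
    [Algebra ℚ K] [Algebra ℚ F] [FiniteDimensional ℚ K] {s : ι → K →ₐ[ℚ] F}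
    (hs : Function.Injective s) {b : ι → K} (hb : LinearIndependent ℚ b)
    (hcard : Fintype.card ι = Module.finrank ℚ K) :
    IsUnit (Matrix.of fun i j => s i (b j)) := by
  rw [← Matrix.linearIndependent_rows_iff_isUnit, Fintype.linearIndependent_iff]
  intro c hc i
  have hspan : Submodule.span ℚ (Set.range b) = ⊤ :=
    hb.span_eq_top_of_card_eq_finrank' hcard
  have h1 : ∀ x : K, ∑ i, c i * s i x = 0 := by
    intro x
    have hx : x ∈ Submodule.span ℚ (Set.range b) := hspan ▸ Submodule.mem_top
    induction hx using Submodule.span_induction with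
    | mem v hv =>
      obtain ⟨j, rfl⟩ := hv
      simpa using congrFun hc j
    | zero => simp
    | add x y _ _ hx hy => simp [mul_add, Finset.sum_add_distrib, hx, hy]
    | smul q x _ hx =>
      simp only [map_smul]
      simp only [Algebra.smul_def, mul_left_comm (c _)]
      rw [← Finset.mul_sum, hx, mul_zero]
  -- A relation between the rows extends from the basis to all of `K`, against Dedekind's
  -- independence of distinct embeddings.
  have h2 : LinearIndependent F (fun i => ((s i : K →* F) : K → F)) :=
    (linearIndependent_monoidHom K F).comp (fun i => (s i : K →* F)) fun i j hij =>
      hs (AlgHom.ext fun x => DFunLike.congr_fun hij x)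
  refine Fintype.linearIndependent_iff.1 h2 c ?_ i
  ext x
  simpa using h1 x

/-- An element fixed by the Galois group that is a polynomial in algebraic integers is a rational
integer. -/
theorem exists_int_eq_aeval_of_invariant {ι L : Type*} [Field L] [NumberField L] [IsGalois ℚ L]
    (f : MvPolynomial ι ℤ) (x : ι → L) (hx : ∀ i, IsIntegral ℤ (x i))
    (hinv : ∀ τ : L ≃ₐ[ℚ] L, aeval (fun i => τ (x i)) f = aeval x f) :
    ∃ z : ℤ, aeval x f = (z : L) := by
  have h1 : aeval x f ∈ Set.range (algebraMap ℚ L) := by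
    rw [IsGalois.mem_range_algebraMap_iff_fixed]
    intro τ
    refine Eq.trans ?_ (hinv τ)
    exact (MvPolynomial.comp_aeval_apply x ((τ : L →ₐ[ℚ] L).restrictScalars ℤ) f)
  obtain ⟨q, hq⟩ := h1
  have h2 : IsIntegral ℤ (aeval x f) := by
    have h3 : aeval x f = algebraMap (integralClosure ℤ L) L
        (aeval (fun i => (⟨x i, hx i⟩ : integralClosure ℤ L)) f) := by
      rw [← aeval_algebraMap_apply]
      rfl
    rw [h3]
    exact (aeval (fun i => (⟨x i, hx i⟩ : integralClosure ℤ L)) f).2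
  rw [← hq, isIntegral_algebraMap_iff (algebraMap ℚ L).injective] at h2
  obtain ⟨z, hz⟩ := IsIntegrallyClosed.isIntegral_iff.1 h2
  refine ⟨z, ?_⟩
  rw [← hq, ← hz]
  simp

end PermutedConjugates

/-! ### Generators of fields and their invariants -/

namespace TraceCount

open MvPolynomial NumberField

instance : Algebra.IsAlgebraic ℚ (AlgebraicClosure ℚ) := AlgebraicClosure.isAlgebraic ℚ

theorem isGalois_galClosure (K : IntermediateField ℚ (AlgebraicClosure ℚ)) [NumberField K] :
    IsGalois ℚ (galClosure K) := by
  have : Normal ℚ (AlgebraicClosure ℚ) := { splits' := fun x => IsAlgClosed.splits _ }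
  have h : Normal ℚ (galClosure K) := by
    have h1 := normalClosure.normal ℚ K (AlgebraicClosure ℚ)
    convert h1
    exact Subsingleton.elim _ _
  exact ⟨⟩

variable {Ω : Type*}

/-- The discriminant polynomial `∏_{i ≠ j} (X_i - X_j)`. -/
noncomputable def diffProd (Ω : Type*) [Fintype Ω] [DecidableEq Ω] : MvPolynomial Ω ℤ :=
  ∏ i : Ω, ∏ j ∈ Finset.univ.erase i, (X i - X j)

theorem diffProd_ne_zero [Fintype Ω] [DecidableEq Ω] : diffProd Ω ≠ 0 := by
  refine Finset.prod_ne_zero_iff.2 fun i _ => Finset.prod_ne_zero_iff.2 fun j hj => ?_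
  rw [sub_ne_zero]
  exact fun h => (Finset.ne_of_mem_erase hj) (X_injective h).symm

theorem injective_of_aeval_diffProd_ne_zero [Fintype Ω] [DecidableEq Ω] {F : Type*} [Field F] {x : Ω → F}
    (h : aeval x (diffProd Ω) ≠ 0) : Function.Injective x := by
  intro i j hij
  by_contra hne
  apply h
  rw [diffProd, map_prod]
  refine Finset.prod_eq_zero (Finset.mem_univ i) ?_
  rw [map_prod]
  refine Finset.prod_eq_zero (Finset.mem_erase.2 ⟨Ne.symm hne, Finset.mem_univ j⟩) ?_
  simp [hij]

variable (G : Subgroup (Equiv.Perm Ω))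

/-- The embeddings of `K` into the algebraic closure of `ℚ`, labelled by `Ω`. -/
noncomputable def labelledEmbedding {K : IntermediateField ℚ (AlgebraicClosure ℚ)}
    (e : (K →ₐ[ℚ] galClosure K) ≃ Ω) (i : Ω) : K →ₐ[ℚ] AlgebraicClosure ℚ :=
  (galClosure K).val.comp (e.symm i)

theorem labelledEmbedding_injective {K : IntermediateField ℚ (AlgebraicClosure ℚ)}
    (e : (K →ₐ[ℚ] galClosure K) ≃ Ω) : Function.Injective (labelledEmbedding e) := by
  intro i j hij
  apply e.symm.injective
  ext x
  exact DFunLike.congr_fun hij x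

theorem exists_labelledEmbedding_eq_val {K : IntermediateField ℚ (AlgebraicClosure ℚ)}
    (e : (K →ₐ[ℚ] galClosure K) ≃ Ω) : ∃ i, labelledEmbedding e i = K.val := by
  let s : K →ₐ[ℚ] galClosure K := IntermediateField.inclusion K.le_normalClosure
  refine ⟨e s, AlgHom.ext fun x => ?_⟩
  have h := DFunLike.congr_fun (e.symm_apply_apply s) x
  exact congrArg (galClosure K).val h

theorem adjoin_eq_of_injective_labelledEmbedding [Fintype Ω]
    {K : IntermediateField ℚ (AlgebraicClosure ℚ)}
    [FiniteDimensional ℚ K] (hK : Module.finrank ℚ K = Fintype.card Ω)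
    (e : (K →ₐ[ℚ] galClosure K) ≃ Ω) (α : K)
    (hα : Function.Injective fun i => labelledEmbedding e i α) :
    IntermediateField.adjoin ℚ {(α : AlgebraicClosure ℚ)} = K := by
  have hbij : Function.Bijective (labelledEmbedding e) := by
    rw [Fintype.bijective_iff_injective_and_card]
    exact ⟨labelledEmbedding_injective e, by rw [AlgHom.card, hK]⟩
  have h1 : IntermediateField.adjoin ℚ {α} = ⊤ := by
    rw [Field.primitive_element_iff_algHom_eq_of_eval' ℚ (AlgebraicClosure ℚ)
      (fun x => IsAlgClosed.splits _)]
    intro σ τ hστ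
    obtain ⟨i, rfl⟩ := hbij.2 σ
    obtain ⟨j, rfl⟩ := hbij.2 τ
    rw [hα hστ]
  -- `K` carries two ℚ-algebra structures, as an intermediate field and as a field of characteristic
  -- zero; they agree because such a structure is unique.
  have h1' : ∀ inst : Algebra ℚ K, @IntermediateField.adjoin ℚ _ K _ inst {α} = ⊤ := by
    intro inst
    obtain rfl : inst = DivisionRing.toRatAlgebra := Subsingleton.elim _ _
    exact h1
  have h2 := IntermediateField.adjoin_map ℚ {α} K.val
  rw [h1', ← AlgHom.fieldRange_eq_map, IntermediateField.fieldRange_val, Set.image_singleton] at h2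
  exact h2.symm

/-- Through `φ` the Galois group permutes the labelled conjugates of α by elements of `G`, so the
value of an invariant is both rational and integral. -/
theorem exists_int_eq_aeval_labelledEmbedding {K : IntermediateField ℚ (AlgebraicClosure ℚ)}
    [NumberField K] (e : (K →ₐ[ℚ] galClosure K) ≃ Ω)
    (φ : (galClosure K ≃ₐ[ℚ] galClosure K) ≃* G)
    (hφ : ∀ (τ : galClosure K ≃ₐ[ℚ] galClosure K) (s : K →ₐ[ℚ] galClosure K),
      e ((τ : galClosure K →ₐ[ℚ] galClosure K).comp s) = (φ τ : Equiv.Perm Ω) (e s))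
    (f : MvPolynomial Ω ℤ) (hf : ∀ g ∈ G, rename g f = f) (α : 𝓞 K) :
    ∃ z : ℤ, aeval (fun i => labelledEmbedding e i (α : K)) f = (z : AlgebraicClosure ℚ) := by
  have : NumberField (galClosure K) := ⟨⟩
  have := isGalois_galClosure K
  obtain ⟨z, hz⟩ := exists_int_eq_aeval_of_invariant f (fun i => e.symm i (α : K))
    (fun i => α.2.map (e.symm i)) (fun τ => by
      have h1 : ∀ i, τ (e.symm i (α : K)) = e.symm ((φ τ : Equiv.Perm Ω) i) (α : K) := by
        intro i
        have h2 := hφ τ (e.symm i)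
        rw [e.apply_symm_apply, ← Equiv.eq_symm_apply] at h2
        exact DFunLike.congr_fun h2 (α : K)
      simp only [h1]
      conv_rhs => rw [← hf _ (φ τ).2, aeval_rename]
      rfl)
  refine ⟨z, ?_⟩
  have h3 : aeval (fun i => labelledEmbedding e i (α : K)) f =
      algebraMap (galClosure K) (AlgebraicClosure ℚ) (aeval (fun i => e.symm i (α : K)) f) := by
    rw [← aeval_algebraMap_apply]
    rfl
  exact h3.trans ((congrArg _ hz).trans (map_intCast _ z))

/-- Every field counted by `fieldsWithGroup G X` is generated by a root of a polynomial
`P(T; Y)` with an integral parameter vector `T` of size `O(X ^ (d / n))`, where `P` is an algebraic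
relation of the variables over the ring generated by invariants `f_j` of degree `d`. -/
theorem exists_parameters_of_mem_fieldsWithGroup [Fintype Ω] [DecidableEq Ω] [Nonempty Ω]
    (f : Ω → MvPolynomial Ω ℤ) (hinv : ∀ j, ∀ g ∈ G, rename g (f j) = f j) {d : ℕ}
    (hhom : ∀ j, (f j).IsHomogeneous d)
    (hind : AlgebraicIndependent ℤ f) (P : Polynomial (MvPolynomial Ω ℤ)) (hP : P ≠ 0)
    (hPX : ∀ i, P.eval₂ (aeval f : MvPolynomial Ω ℤ →ₐ[ℤ] MvPolynomial Ω ℤ).toRingHom (X i) = 0) :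
    ∃ c : ℝ, 0 ≤ c ∧ ∀ Y : ℝ, 1 ≤ Y →
      ∀ K ∈ fieldsWithGroup G (Y ^ Fintype.card Ω),
        ∃ (T : Ω → ℤ) (α : AlgebraicClosure ℚ), (∀ j, |(T j : ℝ)| ≤ c * Y ^ d) ∧
          P.map (eval T) ≠ 0 ∧ Polynomial.aeval α (P.map (eval T)) = 0 ∧
          IntermediateField.adjoin ℚ {α} = K := by
  have hn : Fintype.card Ω ≠ 0 := Fintype.card_ne_zero
  obtain ⟨C, hC, hmin⟩ := exists_linearIndependent_integers_norm_le (Fintype.card Ω) hn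
  choose c hc0 hc using fun j => (hhom j).exists_norm_aeval_le
  -- The two factors guard against the two degenerations: the specialised `P` losing its leading
  -- coefficient, and two conjugates of α coinciding.
  set D : MvPolynomial Ω ℤ := aeval f P.leadingCoeff * diffProd Ω with hD
  have hD0 : D ≠ 0 := by
    refine mul_ne_zero (fun h => hP ?_) diffProd_ne_zero
    exact Polynomial.leadingCoeff_eq_zero.1 (algebraicIndependent_iff.1 hind _ h)
  set B : ℝ := Fintype.card Ω * (D.totalDegree * C) with hB
  have hB0 : 0 ≤ B := by positivity
  have hcsum : 0 ≤ ∑ j, c j := Finset.sum_nonneg fun j _ => hc0 j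
  refine ⟨(∑ j, c j) * B ^ d, by positivity, ?_⟩
  rintro Y hY K ⟨_, hdeg, hdisc, e, φ, hφ⟩
  obtain ⟨a, ha, haσ⟩ := hmin K hdeg
  let r := Fintype.equivFin Ω
  obtain ⟨y, hy, hyD⟩ := exists_aeval_sum_ne_zero D hD0 _
    (isUnit_matrix_embeddings (labelledEmbedding_injective e) (ha.comp r r.injective) hdeg.symm)
  let α : 𝓞 K := ∑ j, (y j : 𝓞 K) * a (r j)
  set x : Ω → AlgebraicClosure ℚ := fun i => labelledEmbedding e i (α : K) with hx
  have hxsum : (fun i => ∑ j, (y j : AlgebraicClosure ℚ) *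
      (Matrix.of fun i j => labelledEmbedding e i (((fun k => (a k : K)) ∘ r) j)) i j) = x := by
    funext i
    simp [hx, α]
  rw [hxsum, hD, map_mul] at hyD
  choose T hT using fun j => exists_int_eq_aeval_labelledEmbedding G e φ hφ (f j) (hinv j) α
  have hcomp : ∀ p : MvPolynomial Ω ℤ,
      aeval x (aeval f p) = ((eval T p : ℤ) : AlgebraicClosure ℚ) := by
    intro p
    have h1 : ((aeval x).comp (aeval f) : MvPolynomial Ω ℤ →ₐ[ℤ] AlgebraicClosure ℚ) =
        (Algebra.ofId ℤ (AlgebraicClosure ℚ)).comp (aeval T) := by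
      refine MvPolynomial.algHom_ext fun j => ?_
      simpa [Algebra.ofId_apply] using hT j
    have h2 := DFunLike.congr_fun h1 p
    simpa [Algebra.ofId_apply, coe_aeval_eq_eval] using h2
  have hroot : ∀ i, Polynomial.aeval (x i) (P.map (eval T)) = 0 := by
    intro i
    have h1 := congrArg (aeval x : MvPolynomial Ω ℤ →ₐ[ℤ] AlgebraicClosure ℚ) (hPX i)
    rw [map_zero] at h1
    have h2 := Polynomial.hom_eval₂ P
      (aeval f : MvPolynomial Ω ℤ →ₐ[ℤ] MvPolynomial Ω ℤ).toRingHom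
      (aeval x : MvPolynomial Ω ℤ →ₐ[ℤ] AlgebraicClosure ℚ).toRingHom (X i)
    rw [Polynomial.aeval_def, Polynomial.eval₂_map, ← h1]
    refine Eq.trans ?_ h2.symm
    have h3 : (algebraMap ℤ (AlgebraicClosure ℚ)).comp (eval T) =
        (aeval x : MvPolynomial Ω ℤ →ₐ[ℤ] AlgebraicClosure ℚ).toRingHom.comp
        (aeval f : MvPolynomial Ω ℤ →ₐ[ℤ] MvPolynomial Ω ℤ).toRingHom :=
      RingHom.ext fun p => (hcomp p).symm
    rw [h3]
    congr 1
    exact (aeval_X x i).symm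
  -- The label of the inclusion of `K` picks out α itself, so the field obtained is `K` and not
  -- merely a conjugate.
  obtain ⟨i₀, hi₀⟩ := exists_labelledEmbedding_eq_val e
  refine ⟨T, x i₀, fun j => ?_, fun h0 => ?_, hroot i₀, ?_⟩
  -- Sizes are measured after an arbitrary embedding into ℂ, since the bounds on the `a i` hold for
  -- all embeddings of `K`.
  · let ρ : AlgebraicClosure ℚ →ₐ[ℚ] ℂ := IsAlgClosed.lift
    have hs : |(discr K : ℝ)| ^ ((Fintype.card Ω : ℕ) : ℝ)⁻¹ ≤ Y := by
      rw [Real.rpow_inv_le_iff_of_pos (abs_nonneg _) (by positivity) (by positivity),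
        Real.rpow_natCast]
      exact hdisc
    have hxb : ∀ i, ‖ρ (x i)‖ ≤ B * Y := by
      intro i
      rw [← hxsum, map_sum]
      have h1 : ∀ j, ‖ρ ((y j : AlgebraicClosure ℚ) * (Matrix.of fun i j =>
          labelledEmbedding e i (((fun k => (a k : K)) ∘ r) j)) i j)‖ ≤
          D.totalDegree * (C * Y) := by
        intro j
        rw [map_mul, norm_mul, map_natCast, Complex.norm_natCast]
        have h2 := haσ (r j) (ρ.comp (labelledEmbedding e i))
        have h3 : (y j : ℝ) ≤ D.totalDegree := by exact_mod_cast hy j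
        refine mul_le_mul h3 (h2.trans ?_) (norm_nonneg _) (by positivity)
        gcongr
      refine (norm_sum_le_of_le _ fun j _ => h1 j).trans ?_
      rw [Finset.sum_const, Finset.card_univ, nsmul_eq_mul, hB]
      exact le_of_eq (by ring)
    have h1 := hc j _ _ hxb
    have h2 : aeval (fun i => ρ (x i)) (f j) = ((T j : ℤ) : ℂ) := by
      have h3 : aeval (fun i => ρ (x i)) (f j) = ρ (aeval x (f j)) := by
        exact (MvPolynomial.comp_aeval_apply x (ρ.restrictScalars ℤ) (f j)).symm
      rw [h3, hT j, map_intCast]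
    rw [h2, Complex.norm_intCast, mul_pow, ← mul_assoc] at h1
    refine h1.trans ?_
    gcongr
    exact Finset.single_le_sum (f := c) (fun j _ => hc0 j) (Finset.mem_univ j)
  · apply hyD
    have h1 : eval T P.leadingCoeff = 0 := by
      have := congrArg (fun q => q.coeff P.natDegree) h0
      simpa using this
    exact mul_eq_zero_of_left ((hcomp _).trans (by rw [h1, Int.cast_zero])) _
  · rw [hx]
    simp only [hi₀]
    exact adjoin_eq_of_injective_labelledEmbedding hdeg e (α : K)
      (injective_of_aeval_diffProd_ne_zero (right_ne_zero_of_mul hyD))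

end TraceCount

/-! ### Counting fields by parameter vectors -/

namespace TraceCount

open MvPolynomial

section Count

variable {Ω : Type*} [Fintype Ω] [DecidableEq Ω]

/-- Upper bound for the number of fields with a given permutation group from algebraically
independent homogeneous invariants of degree `d`. -/
theorem exists_fieldCount_le [Nonempty Ω] (G : Subgroup (Equiv.Perm Ω))
    (f : Ω → MvPolynomial Ω ℤ) (hinv : ∀ j, ∀ g ∈ G, rename g (f j) = f j) {d : ℕ}
    (hhom : ∀ j, (f j).IsHomogeneous d) (hind : AlgebraicIndependent ℤ f) :
    ∃ C : ℝ, 0 < C ∧ ∀ X : ℝ, 1 ≤ X →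
      (fieldsWithGroup G X).Finite ∧ (fieldCount G X : ℝ) ≤ C * X ^ d := by
  classical
  obtain ⟨P, hP, hPX⟩ := hind.exists_polynomial_eval_X_eq_zero
  obtain ⟨c, hc, h⟩ := exists_parameters_of_mem_fieldsWithGroup G f hinv hhom hind P hP hPX
  refine ⟨(2 * c + 1) ^ Fintype.card Ω * (P.natDegree + 1), by positivity, fun X hX => ?_⟩
  set Y : ℝ := X ^ (Fintype.card Ω : ℝ)⁻¹ with hYdef
  have hYX : Y ^ Fintype.card Ω = X :=
    Real.rpow_inv_natCast_pow (by linarith) Fintype.card_ne_zero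
  have hY : 1 ≤ Y := Real.one_le_rpow hX (by positivity)
  set M : ℤ := ⌊c * Y ^ d⌋ with hM
  have hM0 : 0 ≤ M := Int.floor_nonneg.2 (by positivity)
  -- All fields generated by a root of a nonzero specialisation of `P` in the box |T_j| ≤ M; each
  -- `T` contributes at most deg P of them.
  let F : Finset (IntermediateField ℚ (AlgebraicClosure ℚ)) :=
    (Fintype.piFinset fun _ : Ω => Finset.Icc (-M) M).biUnion fun T =>
      ((P.map (eval T)).aroots (AlgebraicClosure ℚ)).toFinset.image
        fun α => IntermediateField.adjoin ℚ {α}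
  have hsub : fieldsWithGroup G X ⊆ F := by
    intro K hK
    rw [← hYX] at hK
    obtain ⟨T, α, hT, hPT, hα, rfl⟩ := h Y hY K hK
    simp only [F, Finset.coe_biUnion, Set.mem_iUnion, Finset.mem_coe, Finset.mem_image,
      Fintype.mem_piFinset, Finset.mem_Icc, Multiset.mem_toFinset]
    refine ⟨T, fun j => ?_, α, (Polynomial.mem_aroots.2 ⟨hPT, hα⟩), rfl⟩
    rw [← abs_le, hM, Int.le_floor]
    exact_mod_cast hT j
  have hcard : F.card ≤ (2 * M + 1).toNat ^ Fintype.card Ω * P.natDegree := by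
    refine (Finset.card_biUnion_le_card_mul _ _ P.natDegree fun T _ => ?_).trans ?_
    · refine Finset.card_image_le.trans ((Multiset.toFinset_card_le _).trans ?_)
      refine (Polynomial.card_roots' _).trans ?_
      exact Polynomial.natDegree_map_le.trans Polynomial.natDegree_map_le
    · rw [Fintype.card_piFinset, Finset.prod_const, Finset.card_univ, Int.card_Icc]
      refine le_of_eq ?_
      congr 3
      ring
  refine ⟨F.finite_toSet.subset hsub, ?_⟩
  have h1 : (fieldCount G X : ℝ) ≤ F.card := by
    have := Set.ncard_le_ncard hsub F.finite_toSet
    rw [Set.ncard_coe_finset] at this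
    exact_mod_cast this
  -- The summand 1 in 2M + 1 is absorbed by Y^d ≥ 1.
  have h2 : ((2 * M + 1).toNat : ℝ) ≤ (2 * c + 1) * Y ^ d := by
    have h3 : ((2 * M + 1).toNat : ℝ) = 2 * (M : ℝ) + 1 := by
      have : (((2 * M + 1).toNat : ℤ) : ℝ) = ((2 * M + 1 : ℤ) : ℝ) := by
        rw [Int.toNat_of_nonneg (by omega)]
      rw [← Int.cast_natCast, this]
      push_cast
      ring
    have h4 : (M : ℝ) ≤ c * Y ^ d := Int.floor_le _
    have h5 : 1 ≤ Y ^ d := one_le_pow₀ hY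
    rw [h3]
    linarith
  calc (fieldCount G X : ℝ) ≤ F.card := h1
    _ ≤ ((2 * M + 1).toNat : ℝ) ^ Fintype.card Ω * P.natDegree := by exact_mod_cast hcard
    _ ≤ ((2 * c + 1) * Y ^ d) ^ Fintype.card Ω * (P.natDegree + 1) := by
      gcongr
      linarith
    _ = _ := by
      rw [mul_pow, ← pow_mul, mul_comm d, pow_mul, hYX]
      ring

end Count

section TraceFunctions

variable {Ω : Type*} (G : Subgroup (Equiv.Perm Ω)) (ω : Ω)

theorem sum_expVec [Finite Ω] {k : ℕ} (t : ℕ) {S : Finset (NH G ω)} (hS : S ∈ subsetsWithOne G ω k) :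
    ∑ c, expVec G ω t S c = k + t - 1 := by
  classical
  obtain ⟨rfl, h1⟩ := hS
  have h2 : ∀ c ∈ Finset.univ.erase (1 : NH G ω), expVec G ω t S c = if c ∈ S then 1 else 0 := by
    intro c hc
    rw [expVec, if_neg (Finset.ne_of_mem_erase hc)]
  rw [← Finset.add_sum_erase _ _ (Finset.mem_univ 1), Finset.sum_congr rfl h2, Finset.sum_boole]
  have h3 : (Finset.univ.erase (1 : NH G ω)).filter (· ∈ S) = S.erase 1 := by
    ext c
    simp
  rw [h3, Finset.card_erase_of_mem h1, expVec, if_pos rfl]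
  have := Finset.card_pos.2 ⟨_, h1⟩
  simp
  omega

variable [MulAction.IsPretransitive G Ω]

/-- π_c is right multiplication on cosets of `H`, so it commutes with the left action of `G`. This
is what makes trace functions invariant. -/
theorem shift_smul (c : NH G ω) (g : G) (i : Ω) : shift G ω c (g • i) = g • shift G ω c i := by
  obtain ⟨u, rfl⟩ := QuotientGroup.mk_surjective c
  obtain ⟨h, rfl⟩ := MulAction.exists_smul_eq G ω i
  rw [← mul_smul, shift_mk_smul, shift_mk_smul, mul_assoc, mul_smul g]

variable [Fintype Ω]

theorem rename_traceFn (a : NH G ω → ℕ) {g : Equiv.Perm Ω} (hg : g ∈ G) :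
    rename g (traceFn G ω a) = traceFn G ω a := by
  rw [traceFn, map_sum]
  conv_rhs => rw [← Equiv.sum_comp g]
  refine Finset.sum_congr rfl fun i _ => ?_
  rw [map_prod]
  refine Finset.prod_congr rfl fun c _ => ?_
  rw [map_pow, rename_X]
  exact congrArg (fun j => (X j : MvPolynomial Ω ℤ) ^ a c) (shift_smul G ω c ⟨g, hg⟩ i).symm

theorem isHomogeneous_traceFn (a : NH G ω → ℕ) :
    (traceFn G ω a).IsHomogeneous (∑ c, a c) :=
  IsHomogeneous.sum _ _ _ fun _ _ => IsHomogeneous.prod _ _ _ fun _ _ => isHomogeneous_X_pow _ _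

end TraceFunctions

end TraceCount

theorem corollaryB {m : ℕ} (A : Subgroup (Equiv.Perm (Fin m)))
    [MulAction.IsPretransitive A (Fin m)]
    (B : Type*) [Group B] [Fintype B] [DecidableEq B]
    (ω : Fin m × B) (k t : ℕ) (hk : 3 ≤ k) (hkB : k ≤ Fintype.card B) (ht : 2 ≤ t)
    (hchoose : m * Fintype.card B ≤ (Fintype.card B - 1).choose (k - 1))
    (hjac : ∃ S : Fin m × B → Finset (TraceCount.NH (TraceCount.prodRegular A B) ω),
      Function.Injective S ∧
      (∀ i, S i ∈ TraceCount.subsetsWithOne (TraceCount.prodRegular A B) ω k) ∧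
      (TraceCount.jacobianMatrix fun i =>
        TraceCount.traceFn (TraceCount.prodRegular A B) ω
          (TraceCount.expVec (TraceCount.prodRegular A B) ω t (S i))).det ≠ 0) :
    ∃ C : ℝ, 0 < C ∧ ∀ X : ℝ, 1 ≤ X →
      (TraceCount.fieldsWithGroup (TraceCount.prodRegular A B) X).Finite ∧
      (TraceCount.fieldCount (TraceCount.prodRegular A B) X : ℝ) ≤ C * X ^ (k + t - 1) := by
  obtain ⟨S, -, hS, hdet⟩ := hjac
  have : Nonempty (Fin m × B) := ⟨ω⟩
  exact TraceCount.exists_fieldCount_le (TraceCount.prodRegular A B) _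
    (fun j _ hg => TraceCount.rename_traceFn _ ω _ hg)
    -- The degree is the sum of the exponents: t at the trivial coset and k - 1 ones, the same for
    -- every subset.
    (fun j => TraceCount.sum_expVec _ ω t (hS j) ▸ TraceCount.isHomogeneous_traceFn _ ω _)
    (algebraicIndependent_of_det_jacobian_ne_zero _ hdet)
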